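/- Let $n\ge 0$, let $\langle x,y\rangle=\sum_{j=1}^n x_j\overline{y_j}$ and $|x|=\sqrt{\langle x,x\rangle}$ on $\mathbb{C}^n$, and let $\mathbb{B}_n=\{x\in\mathbb{C}^n : |x|<1\}$. For $x,y\in\mathbb{B}_n$ put $$\phi_x(y)=\omega_x\!\left(\frac{y-x}{1-\langle y,x\rangle}\right),\qquad \omega_x(w)=\frac{\langle w,x\rangle}{1+\sqrt{1-|x|^2}}\,x+\sqrt{1-|x|^2}\,w .$$ Let $d$ be the Kobayashi pseudodistance of $\mathbb{B}_n$, that is, $$d(x,y)=\inf_\gamma\int_0^1 g(\gamma(t),\gamma'(t))\,dt,$$ the infimum being over all piecewise $C^1$ curves $\gamma:[0,1]\to\mathbb{B}_n$ with $\gamma(0)=x$, $\gamma(1)=y$, where $$g(x,v)=\inf\{1/\tau : \tau>0,\ h:\{\zeta\in\mathbb{C}:|\zeta|<1\}\to\mathbb{B}_n \text{ holomorphic},\ h(0)=x,\ h'(0)=\tau v\}.$$ Then every $\phi_x$ with $x\in\mathbb{B}_n$ is an automorphism of $\mathbb{B}_n$ (a holomorphic bijection of $\mathbb{B}_n$ with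 holomorphic inverse $\phi_x^{-1}$), and $\phi_x(x)=0$, so that $0$ is the identity element of $\mathbb{B}_n$. Define $r\otimes w=\phi_0^{-1}(r\,\phi_0(w))$ for $r\in[0,1]$, $w\in\mathbb{B}_n$. An almost geodesic joining $x,y\in\mathbb{B}_n$ is a curve $\gamma_{x,y}:[0,1]\to\mathbb{B}_n$ of the form $$\gamma_{x,y}(t)=\phi_x^{-1}\big(\alpha(t)\otimes\phi_x(y)\big)$$ for some function $\alpha:[0,1]\to[0,1]$ such that $d\big(0,\alpha(t)\otimes\phi_x(y)\big)=t\,d\big(0,\phi_x(y)\big)$ for all $t\in[0,1]$. For all $x,y\in\mathbb{B}_n$ there is exactly one almost geodesic joining $x$ and $y$, and, with $z=\phi_x(y)$, it is given by $$\gamma_{x,y}(t)=\phi_x^{-1}\!\left(\frac{1}{|z|}\,\frac{(1+|z|)^t-(1-|z|)^t}{(1+|z|)^t+(1-|z|)^t}\;z\right),\qquad t\in[0,1],$$ where the argument of $\phi_x^{-1}$ is read as $0$ if $z=0$ (that is, if $x=y$). -/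

import Mathlib

open Set Metric MeasureTheory
open scoped ENNReal

noncomputable section

namespace ComplexDomain

section General

variable {E : Type*} [NormedAddCommGroup E] [NormedSpace ℂ E]

/-- `f` is an automorphism of `U`: it maps `U` bijectively onto `U`, and both `f` and its inverse
map are holomorphic on `U` (locally given by convergent power series). -/
def IsAutomorphism (U : Set E) (f : E → E) : Prop :=
  BijOn f U U ∧ AnalyticOnNhd ℂ f U ∧ AnalyticOnNhd ℂ (Function.invFunOn f U) U

/-- The Kobayashi differential metric of `D` at the point `x` in the direction `v`: the infimum of
`1 / τ` over all `τ > 0` for which there is a holomorphic map `h` from the open unit disc to `D`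
with `h 0 = x` and `h' 0 = τ v`. -/
def kobayashiMetric (D : Set E) (x v : E) : ℝ≥0∞ :=
  ⨅ (τ : ℝ) (h : ℂ → E) (_ : 0 < τ ∧ AnalyticOnNhd ℂ h (ball (0 : ℂ) 1) ∧
    MapsTo h (ball (0 : ℂ) 1) D ∧ h 0 = x ∧ deriv h 0 = (τ : ℂ) • v),
    ENNReal.ofReal (1 / τ)

/-- `γ` is piecewise continuously differentiable on `[0, 1]`: there are
`0 = s 0 < s 1 < ⋯ < s k = 1` such that `γ` is continuously differentiable on each closed
interval `[s i, s (i + 1)]` (with one-sided derivatives at its end points). -/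
def IsPiecewiseC1 (γ : ℝ → E) : Prop :=
  ∃ (k : ℕ) (s : ℕ → ℝ), s 0 = 0 ∧ s k = 1 ∧
    ∀ i < k, s i < s (i + 1) ∧ ContDiffOn ℝ 1 γ (Icc (s i) (s (i + 1)))

/-- The Kobayashi pseudodistance of `D`: the integrated form of the Kobayashi differential metric,
that is, the infimum of the lengths of the piecewise `C¹` curves `[0, 1] → D` from `x` to `y`.
(The finitely many points where the curve may fail to be differentiable, and the values of `γ`
outside `[0, 1]`, do not affect the integral.) -/
def kobayashiDist (D : Set E) (x y : E) : ℝ≥0∞ :=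
  ⨅ (γ : ℝ → E) (_ : IsPiecewiseC1 γ ∧ MapsTo γ (Icc (0 : ℝ) 1) D ∧ γ 0 = x ∧ γ 1 = y),
    ∫⁻ t in Icc (0 : ℝ) 1, kobayashiMetric D (γ t) (deriv γ t)

/-- `o` is the identity element of `D` for the family of maps `φ x`, `x ∈ D`. -/
def IsIdentityElement (D : Set E) (φ : E → E → E) (o : E) : Prop :=
  o ∈ D ∧ ∀ x ∈ D, φ x x = o

/-- The scalar multiplication `r ⊗ w = φ_o⁻¹ (r φ_o (w))` on `D`, where `o` is the identity
element and `φ_o⁻¹` is the inverse of the map `φ_o : D → D`. -/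
def scalarMul (D : Set E) (φ : E → E → E) (o : E) (r : ℝ) (w : E) : E :=
  Function.invFunOn (φ o) D ((r : ℂ) • φ o w)

/-- `γ : [0, 1] → D` is an almost geodesic joining `x` and `y`, with respect to the automorphisms
`φ`, the identity element `o` and the distance `d` on `D`:
`γ t = φ_x⁻¹ (α t ⊗ φ_x (y))` for some `α : [0, 1] → [0, 1]` which solves
`d (o, α t ⊗ φ_x (y)) = t d (o, φ_x (y))` for all `t ∈ [0, 1]`. -/
def IsAlmostGeodesic (D : Set E) (φ : E → E → E) (o : E) (d : E → E → ℝ≥0∞) (x y : E)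
    (γ : unitInterval → E) : Prop :=
  (∀ t, γ t ∈ D) ∧
    ∃ α : unitInterval → unitInterval,
      (∀ t, d o (scalarMul D φ o (α t) (φ x y)) = ENNReal.ofReal t * d o (φ x y)) ∧
      ∀ t, γ t = Function.invFunOn (φ x) D (scalarMul D φ o (α t) (φ x y))

end General

/-- The complex unit ball in `ℂⁿ`, for the Euclidean norm. -/
def unitBall (n : ℕ) : Set (EuclideanSpace ℂ (Fin n)) :=
  {x | ‖x‖ < 1}

/-- The map `ω_x (y) = (⟨y, x⟩ / (1 + √(1 - |x|²))) x + √(1 - |x|²) y`. The inner product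
`⟨y, x⟩ = ∑ j, y j * conj (x j)` is `inner ℂ x y` in Mathlib, which is linear in the second
variable. -/
def ballOmega {n : ℕ} (x y : EuclideanSpace ℂ (Fin n)) : EuclideanSpace ℂ (Fin n) :=
  (inner ℂ x y / ((1 + Real.sqrt (1 - ‖x‖ ^ 2) : ℝ) : ℂ)) • x +
    ((Real.sqrt (1 - ‖x‖ ^ 2) : ℝ) : ℂ) • y

/-- The map `φ_x (y) = ω_x ((y - x) / (1 - ⟨y, x⟩))`. -/
def ballPhi {n : ℕ} (x y : EuclideanSpace ℂ (Fin n)) : EuclideanSpace ℂ (Fin n) :=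
  ballOmega x ((1 - inner ℂ x y)⁻¹ • (y - x))

end ComplexDomain

end

/-! The map `ballPhi x` is inverted on the ball by `ballPhi (-x)` (`ballPhi_ballPhi_neg`), and
`ballPhi 0` is the identity, so `scalarMul` is ordinary scaling (`scalarMul_ballPhi`). Everything
then rests on `d(0, w) = artanh |w|` (`kobayashiDist_unitBall_zero`). For `≤`, the segment `t ↦ t w`
is tested with Möbius discs in the complex line of `w`. For `≥`, Schwarz–Pick applied to `⟨h ζ, e⟩`
with `|e| ≤ 1` shows that the metric dominates the derivative of `artanh Re⟨γ, e⟩` along a curve;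
one integrates and takes `e = w/|w|`.

The condition on `α` becomes `artanh (α(t)|z|) = t artanh |z|`. As `artanh` is injective, `α(t)|z| =
tanh (t artanh |z|)`, which is the stated quotient of powers. If `z = 0`, then `α` is arbitrary but
the curve is still constant. -/

noncomputable section

namespace ComplexDomain

/-! ### Automorphisms of the ball -/

section Automorphism

variable {n : ℕ}

lemma ballOmega_add (x v w : EuclideanSpace ℂ (Fin n)) :
    ballOmega x (v + w) = ballOmega x v + ballOmega x w := by
  simp only [ballOmega, inner_add_right, add_div, add_smul, smul_add]
  abel

lemma ballOmega_smul (x w : EuclideanSpace ℂ (Fin n)) (c : ℂ) :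
    ballOmega x (c • w) = c • ballOmega x w := by
  simp only [ballOmega, inner_smul_right, smul_add, smul_smul, mul_div_assoc]
  rw [mul_comm c (Complex.ofReal _)]

lemma ballOmega_neg_left (x w : EuclideanSpace ℂ (Fin n)) :
    ballOmega (-x) w = ballOmega x w := by
  simp [ballOmega, neg_div]

lemma sqrt_one_sub_norm_sq {x : EuclideanSpace ℂ (Fin n)} (hx : ‖x‖ < 1) :
    ((Real.sqrt (1 - ‖x‖ ^ 2) : ℝ) : ℂ) ^ 2 = 1 - (‖x‖ : ℂ) ^ 2 := by
  have h : 0 ≤ 1 - ‖x‖ ^ 2 := by nlinarith [norm_nonneg x]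
  rw [← Complex.ofReal_pow, Real.sq_sqrt h]
  push_cast; rfl

lemma one_add_sqrt_ne_zero (x : EuclideanSpace ℂ (Fin n)) :
    (1 + (Real.sqrt (1 - ‖x‖ ^ 2) : ℝ) : ℂ) ≠ 0 := by
  have : (1 + Real.sqrt (1 - ‖x‖ ^ 2) : ℝ) ≠ 0 := by positivity
  exact_mod_cast this

lemma inner_ballOmega {x : EuclideanSpace ℂ (Fin n)} (hx : ‖x‖ < 1)
    (w : EuclideanSpace ℂ (Fin n)) : inner ℂ x (ballOmega x w) = inner ℂ x w := by
  have hs := sqrt_one_sub_norm_sq hx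
  have h1 := one_add_sqrt_ne_zero x
  simp only [ballOmega, inner_add_right, inner_smul_right, inner_self_eq_norm_sq_to_K,
    Complex.coe_algebraMap, Complex.ofReal_add, Complex.ofReal_one]
  generalize ((Real.sqrt (1 - ‖x‖ ^ 2) : ℝ) : ℂ) = s at *
  have hX : (‖x‖ : ℂ) ^ 2 = 1 - s ^ 2 := by rw [hs]; ring
  rw [hX]
  field_simp
  ring

/-- With `s = √(1 - |x|²)`, `ω_x` is the identity on `ℂ x` and `s` times the identity on its
orthogonal complement; here `|x|² / (1 + s) + s = 1`. -/
lemma ballOmega_self {x : EuclideanSpace ℂ (Fin n)} (hx : ‖x‖ < 1) : ballOmega x x = x := by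
  have hs := sqrt_one_sub_norm_sq hx
  have h1 := one_add_sqrt_ne_zero x
  simp only [ballOmega, inner_self_eq_norm_sq_to_K,
    Complex.coe_algebraMap, Complex.ofReal_add, Complex.ofReal_one, ← add_smul]
  generalize ((Real.sqrt (1 - ‖x‖ ^ 2) : ℝ) : ℂ) = s at *
  have hX : (‖x‖ : ℂ) ^ 2 = 1 - s ^ 2 := by rw [hs]; ring
  rw [hX]
  convert one_smul ℂ x
  field_simp
  ring

lemma ballOmega_ballOmega {x : EuclideanSpace ℂ (Fin n)} (hx : ‖x‖ < 1)
    (w : EuclideanSpace ℂ (Fin n)) :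
    ballOmega x (ballOmega x w) = inner ℂ x w • x + (1 - (‖x‖ : ℂ) ^ 2) • w := by
  have hs := sqrt_one_sub_norm_sq hx
  have h1 := one_add_sqrt_ne_zero x
  rw [ballOmega, inner_ballOmega hx, ballOmega, ← hs, smul_add, smul_smul, smul_smul, ← add_assoc,
    ← add_smul]
  congr 2
  · push_cast
    field_simp
  · exact (pow_two _).symm

lemma norm_ballOmega_sq {x : EuclideanSpace ℂ (Fin n)} (hx : ‖x‖ < 1)
    (w : EuclideanSpace ℂ (Fin n)) :
    ‖ballOmega x w‖ ^ 2 = ‖inner ℂ x w‖ ^ 2 + (1 - ‖x‖ ^ 2) * ‖w‖ ^ 2 := by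
  have h : 0 ≤ 1 - ‖x‖ ^ 2 := by nlinarith [norm_nonneg x]
  have hs := Real.sq_sqrt h
  have h0 := Real.sqrt_nonneg (1 - ‖x‖ ^ 2)
  rw [ballOmega, norm_add_sq (𝕜 := ℂ), norm_smul, norm_smul, inner_smul_left, inner_smul_right,
    norm_div, Complex.norm_real, Complex.norm_real]
  generalize Real.sqrt (1 - ‖x‖ ^ 2) = s at *
  have hX : ‖x‖ ^ 2 = 1 - s ^ 2 := by rw [hs]; ring
  have hre : RCLike.re ((starRingEnd ℂ) (inner ℂ x w / ((1 + s : ℝ) : ℂ)) *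
      ((s : ℂ) * inner ℂ x w)) = s / (1 + s) * ‖inner ℂ x w‖ ^ 2 := by
    have : (starRingEnd ℂ) (inner ℂ x w / ((1 + s : ℝ) : ℂ)) * ((s : ℂ) * inner ℂ x w)
        = ((s / (1 + s) * ‖inner ℂ x w‖ ^ 2 : ℝ) : ℂ) := by
      rw [map_div₀, Complex.conj_ofReal]
      push_cast
      rw [← Complex.conj_mul']
      ring
    rw [this]; exact Complex.ofReal_re _
  rw [hre, mul_pow, mul_pow, hX, Real.norm_of_nonneg h0, Real.norm_of_nonneg (by positivity)]
  have h1 : (1 + s) ≠ 0 := by positivity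
  field_simp
  ring

lemma one_sub_inner_ne_zero {x y : EuclideanSpace ℂ (Fin n)} (hx : ‖x‖ < 1) (hy : ‖y‖ < 1) :
    (1 : ℂ) - inner ℂ x y ≠ 0 := by
  intro h
  have h1 : ‖inner ℂ x y‖ = 1 := by rw [← sub_eq_zero.mp h]; simp
  have := norm_inner_le_norm (𝕜 := ℂ) x y
  nlinarith [norm_nonneg x, norm_nonneg y]

/-- Positivity of the right side is what keeps `φ_x` inside the ball. -/
lemma norm_ballPhi_sq {x y : EuclideanSpace ℂ (Fin n)} (hx : ‖x‖ < 1) (hy : ‖y‖ < 1) :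
    1 - ‖ballPhi x y‖ ^ 2 =
      (1 - ‖x‖ ^ 2) * (1 - ‖y‖ ^ 2) / ‖1 - inner ℂ x y‖ ^ 2 := by
  have hD : ‖1 - inner ℂ x y‖ ≠ 0 := norm_ne_zero_iff.mpr (one_sub_inner_ne_zero hx hy)
  rw [ballPhi, norm_ballOmega_sq hx, inner_smul_right, norm_smul, norm_mul, norm_inv, mul_pow,
    mul_pow, inv_pow, inner_sub_right, norm_sub_sq (𝕜 := ℂ) y x, ← inner_conj_symm y x,
    inner_self_eq_norm_sq_to_K]
  field_simp
  generalize inner ℂ x y = c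
  have e1 : ‖1 - c‖ ^ 2 = (1 - c.re) ^ 2 + c.im ^ 2 := by
    rw [← Complex.normSq_eq_norm_sq, Complex.normSq_apply]; simp; ring
  have e2 : ‖c - (algebraMap ℝ ℂ ‖x‖) ^ 2‖ ^ 2 = (c.re - ‖x‖ ^ 2) ^ 2 + c.im ^ 2 := by
    have : (algebraMap ℝ ℂ ‖x‖) ^ 2 = ((‖x‖ ^ 2 : ℝ) : ℂ) := by push_cast; rfl
    rw [this, ← Complex.normSq_eq_norm_sq, Complex.normSq_apply, Complex.sub_re, Complex.sub_im,
      Complex.ofReal_re, Complex.ofReal_im]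
    ring
  have e3 : RCLike.re ((starRingEnd ℂ) c) = c.re := Complex.conj_re c
  rw [e3]
  erw [e2]
  rw [e1]
  ring

lemma ballPhi_mem {x y : EuclideanSpace ℂ (Fin n)} (hx : x ∈ unitBall n) (hy : y ∈ unitBall n) :
    ballPhi x y ∈ unitBall n := by
  simp only [unitBall, mem_ofPred_eq] at *
  have hD : 0 < ‖1 - inner ℂ x y‖ := norm_pos_iff.mpr (one_sub_inner_ne_zero hx hy)
  have h1 : 0 < 1 - ‖x‖ ^ 2 := by nlinarith [norm_nonneg x]
  have h2 : 0 < 1 - ‖y‖ ^ 2 := by nlinarith [norm_nonneg y]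
  have : 0 < 1 - ‖ballPhi x y‖ ^ 2 := by
    rw [norm_ballPhi_sq hx hy]; positivity
  nlinarith [norm_nonneg (ballPhi x y)]

lemma neg_mem_unitBall {x : EuclideanSpace ℂ (Fin n)} (hx : x ∈ unitBall n) :
    -x ∈ unitBall n := by
  simpa [unitBall] using hx

/-- Since `x = ω_x x`, subtracting `x` from `φ_{-x}(u)` leaves a multiple of `ω_x (u - ⟨u, x⟩ x)`. A
second `ω_x` turns this into the same multiple of `(1 - |x|²) u`, and the denominator of `φ_x`
cancels the scalars. -/
lemma ballPhi_ballPhi_neg {x u : EuclideanSpace ℂ (Fin n)} (hx : x ∈ unitBall n)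
    (hu : u ∈ unitBall n) : ballPhi x (ballPhi (-x) u) = u := by
  have hx' : ‖x‖ < 1 := hx
  have hc : (1 : ℂ) + inner ℂ x u ≠ 0 := by
    simpa [inner_neg_left] using one_sub_inner_ne_zero (neg_mem_unitBall hx) hu
  have hX : (1 : ℂ) - (‖x‖ : ℂ) ^ 2 ≠ 0 := by
    have : (1 : ℝ) - ‖x‖ ^ 2 ≠ 0 := by nlinarith [norm_nonneg x]
    exact_mod_cast this
  have hv : ballPhi (-x) u = (1 + inner ℂ x u)⁻¹ • ballOmega x (u + x) := by
    rw [ballPhi, ballOmega_neg_left, ballOmega_smul, inner_neg_left, sub_neg_eq_add,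
      sub_neg_eq_add]
  have hi : inner ℂ x (ballPhi (-x) u) =
      (1 + inner ℂ x u)⁻¹ * (inner ℂ x u + (‖x‖ : ℂ) ^ 2) := by
    rw [hv, inner_smul_right, inner_ballOmega hx', inner_add_right, inner_self_eq_norm_sq_to_K]
    rfl
  have hd : ballPhi (-x) u - x =
      (1 + inner ℂ x u)⁻¹ • ballOmega x (u + (-inner ℂ x u) • x) := by
    rw [hv, ballOmega_add, ballOmega_add, ballOmega_smul, ballOmega_self hx', smul_add, smul_add,
      add_sub_assoc, smul_smul]
    congr 1
    have : (1 + inner ℂ x u)⁻¹ * -inner ℂ x u = (1 + inner ℂ x u)⁻¹ - 1 := by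
      field_simp
      ring
    rw [this, sub_smul, one_smul]
  have hi' : 1 - inner ℂ x (ballPhi (-x) u) = (1 + inner ℂ x u)⁻¹ * (1 - (‖x‖ : ℂ) ^ 2) := by
    rw [hi]
    field_simp
    ring
  rw [ballPhi, hi', hd, ballOmega_smul, ballOmega_smul, ballOmega_ballOmega hx', smul_smul,
    inner_add_right, inner_smul_right, inner_self_eq_norm_sq_to_K]
  have hk : ((RCLike.ofReal ‖x‖ : ℂ)) = (‖x‖ : ℂ) := rfl
  rw [hk]
  have h1 : ((1 + inner ℂ x u)⁻¹ * (1 - (‖x‖ : ℂ) ^ 2))⁻¹ * (1 + inner ℂ x u)⁻¹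
      = (1 - (‖x‖ : ℂ) ^ 2)⁻¹ := by
    field_simp
  rw [h1]
  have h2 : inner ℂ x u + -inner ℂ x u * (‖x‖ : ℂ) ^ 2
      = (1 - (‖x‖ : ℂ) ^ 2) * inner ℂ x u := by ring
  rw [h2, mul_smul, ← smul_add, smul_smul, inv_mul_cancel₀ hX, one_smul, neg_smul]
  abel

lemma ballPhi_neg_ballPhi {x u : EuclideanSpace ℂ (Fin n)} (hx : x ∈ unitBall n)
    (hu : u ∈ unitBall n) : ballPhi (-x) (ballPhi x u) = u := by
  simpa using ballPhi_ballPhi_neg (neg_mem_unitBall hx) hu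

lemma bijOn_ballPhi {x : EuclideanSpace ℂ (Fin n)} (hx : x ∈ unitBall n) :
    BijOn (ballPhi x) (unitBall n) (unitBall n) :=
  BijOn.mk (fun _ hy => ballPhi_mem hx hy)
    (fun y hy y' hy' h => by rw [← ballPhi_neg_ballPhi hx hy, h, ballPhi_neg_ballPhi hx hy'])
    (fun u hu => ⟨_, ballPhi_mem (neg_mem_unitBall hx) hu, ballPhi_ballPhi_neg hx hu⟩)

lemma invFunOn_ballPhi {x u : EuclideanSpace ℂ (Fin n)} (hx : x ∈ unitBall n)
    (hu : u ∈ unitBall n) :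
    Function.invFunOn (ballPhi x) (unitBall n) u = ballPhi (-x) u := by
  have h := (bijOn_ballPhi hx).surjOn hu
  exact (bijOn_ballPhi hx).injOn (Function.invFunOn_mem h) (ballPhi_mem (neg_mem_unitBall hx) hu)
    ((Function.invFunOn_eq h).trans (ballPhi_ballPhi_neg hx hu).symm)

lemma analyticOnNhd_ballPhi {x : EuclideanSpace ℂ (Fin n)} (hx : x ∈ unitBall n) :
    AnalyticOnNhd ℂ (ballPhi x) (unitBall n) := by
  intro y hy
  have hi : ∀ f : EuclideanSpace ℂ (Fin n) → EuclideanSpace ℂ (Fin n), AnalyticAt ℂ f y →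
      AnalyticAt ℂ (fun y => inner ℂ x (f y)) y := fun f hf =>
    ((innerSL ℂ x).analyticAt (f y)).comp hf
  have hc := hi _ analyticAt_id
  have hv : AnalyticAt ℂ (fun y => (1 - inner ℂ x y)⁻¹ • (y - x)) y :=
    ((analyticAt_const.sub hc).inv (one_sub_inner_ne_zero hx hy)).smul
      (analyticAt_id.sub analyticAt_const)
  exact ((hi _ hv).div_const.smul analyticAt_const).add hv.fun_const_smul

lemma isOpen_unitBall : IsOpen (unitBall n) := isOpen_lt continuous_norm continuous_const

lemma isAutomorphism_ballPhi {x : EuclideanSpace ℂ (Fin n)} (hx : x ∈ unitBall n) :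
    IsAutomorphism (unitBall n) (ballPhi x) :=
  ⟨bijOn_ballPhi hx, analyticOnNhd_ballPhi hx,
    (analyticOnNhd_ballPhi (neg_mem_unitBall hx)).congr isOpen_unitBall
      fun _ hu => (invFunOn_ballPhi hx hu).symm⟩

lemma ballPhi_zero (w : EuclideanSpace ℂ (Fin n)) : ballPhi 0 w = w := by
  simp [ballPhi, ballOmega]

lemma isIdentityElement_ballPhi :
    IsIdentityElement (unitBall n) ballPhi (0 : EuclideanSpace ℂ (Fin n)) :=
  ⟨by simp [unitBall], fun x _ => by simp [ballPhi, ballOmega]⟩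

lemma scalarMul_ballPhi {r : ℝ} (hr : r ∈ Icc (0 : ℝ) 1) {w : EuclideanSpace ℂ (Fin n)}
    (hw : w ∈ unitBall n) :
    (r : ℂ) • w ∈ unitBall n ∧ scalarMul (unitBall n) ballPhi 0 r w = (r : ℂ) • w := by
  have h0 : (0 : EuclideanSpace ℂ (Fin n)) ∈ unitBall n := isIdentityElement_ballPhi.1
  have hm : (r : ℂ) • w ∈ unitBall n := by
    have hw' : ‖w‖ < 1 := hw
    have : ‖(r : ℂ) • w‖ < 1 := by
      rw [norm_smul, Complex.norm_real, Real.norm_of_nonneg hr.1]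
      nlinarith [norm_nonneg w, hr.2]
    exact this
  refine ⟨hm, ?_⟩
  rw [scalarMul, ballPhi_zero, invFunOn_ballPhi h0 hm, neg_zero, ballPhi_zero]

end Automorphism
-- Möbius maps of the disc and the Schwarz–Pick lemma
section Moebius

lemma one_sub_conj_mul_ne_zero {a w : ℂ} (ha : ‖a‖ < 1) (hw : ‖w‖ < 1) :
    1 - (starRingEnd ℂ) a * w ≠ 0 := by
  intro h
  have h1 : ‖(starRingEnd ℂ) a * w‖ = 1 := by rw [← sub_eq_zero.mp h]; simp
  rw [norm_mul, Complex.norm_conj] at h1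
  nlinarith [norm_nonneg a, norm_nonneg w]

lemma norm_moebius_lt_one {a w : ℂ} (ha : ‖a‖ < 1) (hw : ‖w‖ < 1) :
    ‖(w - a) / (1 - (starRingEnd ℂ) a * w)‖ < 1 := by
  have hD : 0 < ‖1 - (starRingEnd ℂ) a * w‖ := norm_pos_iff.mpr (one_sub_conj_mul_ne_zero ha hw)
  rw [norm_div, div_lt_one hD]
  refine lt_of_pow_lt_pow_left₀ 2 (norm_nonneg _) ?_
  have h : ‖1 - (starRingEnd ℂ) a * w‖ ^ 2 - ‖w - a‖ ^ 2 = (1 - ‖a‖ ^ 2) * (1 - ‖w‖ ^ 2) := by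
    simp only [← Complex.normSq_eq_norm_sq, Complex.normSq_apply, Complex.sub_re, Complex.sub_im,
      Complex.mul_re, Complex.mul_im, Complex.conj_re, Complex.conj_im, Complex.one_re,
      Complex.one_im]
    ring
  have h1 : 0 < 1 - ‖a‖ ^ 2 := by nlinarith [norm_nonneg a]
  have h2 : 0 < 1 - ‖w‖ ^ 2 := by nlinarith [norm_nonneg w]
  have := mul_pos h1 h2
  linarith

lemma hasDerivAt_moebius {a w : ℂ} (ha : ‖a‖ < 1) (hw : ‖w‖ < 1) :
    HasDerivAt (fun w => (w - a) / (1 - (starRingEnd ℂ) a * w))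
      ((1 - (starRingEnd ℂ) a * a) / (1 - (starRingEnd ℂ) a * w) ^ 2) w := by
  have h := ((hasDerivAt_id w).sub_const a).fun_div
    (((hasDerivAt_id w).const_mul ((starRingEnd ℂ) a)).const_sub 1)
    (one_sub_conj_mul_ne_zero ha hw)
  refine h.congr_deriv ?_
  simp only [id]
  congr 1
  ring

lemma norm_one_sub_conj_mul_self {a : ℂ} (ha : ‖a‖ < 1) :
    ‖1 - (starRingEnd ℂ) a * a‖ = 1 - ‖a‖ ^ 2 := by
  rw [Complex.conj_mul']
  have : (1 : ℂ) - (‖a‖ : ℂ) ^ 2 = ((1 - ‖a‖ ^ 2 : ℝ) : ℂ) := by push_cast; rfl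
  rw [this, Complex.norm_real, Real.norm_of_nonneg]
  nlinarith [norm_nonneg a]

/-- The Schwarz-Pick lemma at the centre of the disc. -/
lemma norm_deriv_zero_le_one_sub_norm_sq {f : ℂ → ℂ} (hf : DifferentiableOn ℂ f (ball 0 1))
    (hm : MapsTo f (ball 0 1) (ball 0 1)) : ‖deriv f 0‖ ≤ 1 - ‖f 0‖ ^ 2 := by
  have h0 : (0 : ℂ) ∈ ball (0 : ℂ) 1 := mem_ball_self one_pos
  have hlt : ∀ ζ ∈ ball (0 : ℂ) 1, ‖f ζ‖ < 1 := fun ζ hζ => by simpa using hm hζ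
  have ha := hlt 0 h0
  -- `M` moves `f 0` to `0` with `|M'(f 0)| = 1 / (1 - |f 0|²)`, so the Schwarz lemma for `M ∘ f`
  -- gives the bound.
  set M : ℂ → ℂ := fun w => (w - f 0) / (1 - (starRingEnd ℂ) (f 0) * w) with hM
  have hd : DifferentiableOn ℂ (fun ζ => M (f ζ)) (ball 0 1) := fun ζ hζ =>
    (hasDerivAt_moebius ha (hlt ζ hζ)).differentiableAt.comp_differentiableWithinAt ζ (hf ζ hζ)
  have hz : M (f 0) = 0 := by simp [hM]
  have hmaps : MapsTo (fun ζ => M (f ζ)) (ball 0 1) (closedBall (M (f 0)) 1) := fun ζ hζ => by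
    rw [hz, mem_closedBall_zero_iff]
    exact (norm_moebius_lt_one ha (hlt ζ hζ)).le
  have hS := Complex.norm_deriv_le_one_of_mapsTo_ball hd hmaps one_pos
  have hf0 : HasDerivAt f (deriv f 0) 0 :=
    ((hf 0 h0).differentiableAt (isOpen_ball.mem_nhds h0)).hasDerivAt
  have hpos : 0 < 1 - ‖f 0‖ ^ 2 := by nlinarith [norm_nonneg (f 0)]
  have hc : HasDerivAt (fun ζ => M (f ζ)) _ 0 := (hasDerivAt_moebius ha ha).comp 0 hf0
  rw [hc.deriv, norm_mul, norm_div, norm_pow, norm_one_sub_conj_mul_self ha,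
    div_mul_eq_mul_div, div_le_one (by positivity), sq (1 - ‖f 0‖ ^ 2)] at hS
  exact le_of_mul_le_mul_left hS hpos

end Moebius

/-! ### Calculus of `artanh` -/

section Artanh

lemma hasDerivAt_artanh {x : ℝ} (hx : x ∈ Ioo (-1 : ℝ) 1) :
    HasDerivAt Real.artanh (1 / (1 - x ^ 2)) x := by
  have h1 : 0 < 1 + x := by linarith [hx.1]
  have h2 : 0 < 1 - x := by linarith [hx.2]
  have h : HasDerivAt (fun x : ℝ => 1 / 2 * Real.log ((1 + x) / (1 - x))) (1 / (1 - x ^ 2)) x := by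
    have := ((((hasDerivAt_id x).const_add 1).fun_div ((hasDerivAt_id x).const_sub 1) h2.ne').log
      (div_pos h1 h2).ne').const_mul (1 / 2)
    refine this.congr_deriv ?_
    simp only [id]
    have h3 : 1 - x ^ 2 ≠ 0 := by nlinarith
    field_simp
    ring
  refine h.congr_of_eventuallyEq ?_
  filter_upwards [Ioo_mem_nhds hx.1 hx.2] with y hy
  exact Real.artanh_eq_half_log (Ioo_subset_Icc_self hy)

lemma rpow_quotient_mem_Ioo {r t : ℝ} (hr : r ∈ Ioo (-1 : ℝ) 1) :
    ((1 + r) ^ t - (1 - r) ^ t) / ((1 + r) ^ t + (1 - r) ^ t) ∈ Ioo (-1 : ℝ) 1 := by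
  have h1 : 0 < (1 + r) ^ t := Real.rpow_pos_of_pos (by linarith [hr.1]) t
  have h2 : 0 < (1 - r) ^ t := Real.rpow_pos_of_pos (by linarith [hr.2]) t
  constructor
  · rw [lt_div_iff₀ (by positivity)]; linarith
  · rw [div_lt_iff₀ (by positivity)]; linarith

/-- As `artanh r = ½ log ((1 + r) / (1 - r))`, multiplying by `t` means raising the ratio to the
power `t`. -/
lemma artanh_rpow_quotient {r t : ℝ} (hr : r ∈ Ioo (-1 : ℝ) 1) :
    Real.artanh (((1 + r) ^ t - (1 - r) ^ t) / ((1 + r) ^ t + (1 - r) ^ t)) =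
      t * Real.artanh r := by
  have h1 : 0 < 1 + r := by linarith [hr.1]
  have h2 : 0 < 1 - r := by linarith [hr.2]
  have h3 : 0 < (1 + r) ^ t := Real.rpow_pos_of_pos h1 t
  have h4 : 0 < (1 - r) ^ t := Real.rpow_pos_of_pos h2 t
  rw [Real.artanh_eq_half_log (Ioo_subset_Icc_self (rpow_quotient_mem_Ioo hr)),
    Real.artanh_eq_half_log (Ioo_subset_Icc_self hr)]
  have : (1 + ((1 + r) ^ t - (1 - r) ^ t) / ((1 + r) ^ t + (1 - r) ^ t)) /
      (1 - ((1 + r) ^ t - (1 - r) ^ t) / ((1 + r) ^ t + (1 - r) ^ t)) =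
      ((1 + r) / (1 - r)) ^ t := by
    rw [Real.div_rpow h1.le h2.le]
    generalize (1 + r) ^ t = A at *
    generalize (1 - r) ^ t = B at *
    have e1 : 1 + (A - B) / (A + B) = 2 * A / (A + B) := by field_simp; ring
    have e2 : 1 - (A - B) / (A + B) = 2 * B / (A + B) := by field_simp; ring
    rw [e1, e2]
    field_simp
  rw [this, Real.log_rpow (div_pos h1 h2)]
  ring

end Artanh

/-! ### The Kobayashi distance from the centre -/

section Kobayashi

variable {n : ℕ}

/-- The constant disc is admissible for every `τ`, so `1 / τ` is arbitrarily small. -/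
lemma kobayashiMetric_zero {E : Type*} [NormedAddCommGroup E] [NormedSpace ℂ E] {D : Set E}
    {x : E} (hx : x ∈ D) : kobayashiMetric D x 0 = 0 := by
  refine le_antisymm ?_ zero_le
  refine ENNReal.le_of_forall_pos_le_add fun ε hε _ => ?_
  have hε' : (0 : ℝ) < ε := hε
  refine (iInf₂_le_of_le (1 / (ε : ℝ)) (fun _ => x) (iInf_le_of_le
    ⟨by positivity, analyticOnNhd_const, fun _ _ => hx, rfl, by simp⟩ le_rfl)).trans ?_
  simp

lemma kobayashiMetric_radial_le {w : EuclideanSpace ℂ (Fin n)} (hw : ‖w‖ < 1) {t : ℝ}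
    (ht : t ∈ Icc (0 : ℝ) 1) :
    kobayashiMetric (unitBall n) (t • w) w ≤
      ENNReal.ofReal (‖w‖ * (1 / (1 - (‖w‖ * t) ^ 2))) := by
  rcases eq_or_ne w 0 with rfl | hw0
  · rw [smul_zero, kobayashiMetric_zero (by simp [unitBall])]
    exact zero_le
  have hr : 0 < ‖w‖ := norm_pos_iff.mpr hw0
  have hrc : (‖w‖ : ℂ) ≠ 0 := by exact_mod_cast hr.ne'
  have hb : ‖w‖ * t < 1 := by nlinarith [ht.1, ht.2]
  have hb0 : 0 ≤ ‖w‖ * t := mul_nonneg hr.le ht.1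
  have hb2 : 0 < 1 - (‖w‖ * t) ^ 2 := by nlinarith
  -- The sign gives `M 0 = ‖w‖ t`; then `M' 0 = 1 - (‖w‖ t)²`, which dictates `τ` below.
  set a : ℂ := ((-(‖w‖ * t) : ℝ) : ℂ) with ha
  have hconj : (starRingEnd ℂ) a = a := Complex.conj_ofReal _
  have han : ‖a‖ < 1 := by
    rw [ha, Complex.norm_real, norm_neg, Real.norm_of_nonneg hb0]; exact hb
  have hlt : ∀ ζ ∈ ball (0 : ℂ) 1, ‖ζ‖ < 1 := fun ζ hζ => by simpa using hζ
  set M : ℂ → ℂ := fun ζ => (ζ - a) / (1 - (starRingEnd ℂ) a * ζ) with hM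
  have hd : DifferentiableOn ℂ (fun ζ => M ζ • ((‖w‖ : ℂ)⁻¹ • w)) (ball 0 1) := fun ζ hζ =>
    ((hasDerivAt_moebius han (hlt ζ hζ)).differentiableAt.smul_const _).differentiableWithinAt
  refine (iInf₂_le_of_le ((1 - (‖w‖ * t) ^ 2) / ‖w‖) (fun ζ => M ζ • ((‖w‖ : ℂ)⁻¹ • w))
    (iInf_le_of_le ⟨by positivity, hd.analyticOnNhd isOpen_ball, fun ζ hζ => ?_, ?_, ?_⟩
      le_rfl)).trans ?_
  · refine ENNReal.ofReal_le_ofReal (le_of_eq ?_)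
    field_simp
  · have h := norm_moebius_lt_one han (hlt ζ hζ)
    have : ‖M ζ • ((‖w‖ : ℂ)⁻¹ • w)‖ < 1 := by
      rw [norm_smul, norm_smul, norm_inv, Complex.norm_real, norm_norm, inv_mul_cancel₀ hr.ne',
        mul_one]
      exact h
    exact this
  · have : M 0 = ((‖w‖ * t : ℝ) : ℂ) := by simp [hM, ha]
    beta_reduce
    rw [this, smul_smul, ← Complex.coe_smul]
    congr 1
    push_cast
    field_simp
  · have h := (hasDerivAt_moebius (w := 0) han (by simp)).smul_const ((‖w‖ : ℂ)⁻¹ • w)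
    rw [h.deriv, hconj, smul_smul, ha]
    congr 1
    push_cast
    field_simp
    ring

/-- Real parts of unit linear functionals bound the Kobayashi metric of the ball from below. -/
lemma le_kobayashiMetric {e : EuclideanSpace ℂ (Fin n)} (he : ‖e‖ ≤ 1)
    (x v : EuclideanSpace ℂ (Fin n)) :
    ENNReal.ofReal ((inner ℂ e v).re / (1 - (inner ℂ e x).re ^ 2)) ≤
      kobayashiMetric (unitBall n) x v := by
  refine le_iInf₂ fun τ h => le_iInf fun ⟨hτ, ha, hm, h0, hdv⟩ => ?_
  refine ENNReal.ofReal_le_ofReal ?_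
  have hmem : (0 : ℂ) ∈ ball (0 : ℂ) 1 := mem_ball_self one_pos
  have hle : ∀ y : EuclideanSpace ℂ (Fin n), ‖inner ℂ e y‖ ≤ ‖y‖ := fun y =>
    (norm_inner_le_norm e y).trans (mul_le_of_le_one_left (norm_nonneg y) he)
  have hmf : MapsTo (fun ζ => (inner ℂ e (h ζ) : ℂ)) (ball 0 1) (ball 0 1) := fun ζ hζ => by
    rw [mem_ball_zero_iff]
    exact (hle _).trans_lt (hm hζ)
  have hd : DifferentiableOn ℂ (fun ζ => (inner ℂ e (h ζ) : ℂ)) (ball 0 1) := fun ζ hζ =>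
    ((innerSL ℂ e).differentiableAt.comp ζ (ha ζ hζ).differentiableAt).differentiableWithinAt
  have hS := norm_deriv_zero_le_one_sub_norm_sq hd hmf
  have hder : HasDerivAt (fun ζ => (inner ℂ e (h ζ) : ℂ)) (inner ℂ e (deriv h 0)) 0 :=
    (innerSL ℂ e).hasFDerivAt.comp_hasDerivAt 0 (ha 0 hmem).differentiableAt.hasDerivAt
  have hx1 : ‖(inner ℂ e x : ℂ)‖ < 1 := by
    have := hmf hmem
    rw [mem_ball_zero_iff] at this
    rwa [← h0]
  rw [hder.deriv, hdv, h0, inner_smul_right, norm_mul, Complex.norm_real,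
    Real.norm_of_nonneg hτ.le] at hS
  -- Passing from moduli to real parts only weakens the bound, and yields the derivative of a real
  -- `artanh` along a curve.
  have hv := Complex.re_le_norm (inner ℂ e v)
  have hx := Complex.abs_re_le_norm (inner ℂ e x)
  have hx2 : (inner ℂ e x).re ^ 2 ≤ ‖(inner ℂ e x : ℂ)‖ ^ 2 := by
    rw [← sq_abs]; gcongr
  have hpos : 0 < 1 - (inner ℂ e x).re ^ 2 := by nlinarith [norm_nonneg (inner ℂ e x : ℂ)]
  rw [div_le_div_iff₀ hpos hτ, one_mul]
  nlinarith

/-- Needed for integrands of varying sign: `Re⟨γ', e⟩` may be negative. -/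
lemma ofReal_integral_le_lintegral_ofReal {X : Type*} [MeasurableSpace X] {μ : Measure X}
    {f : X → ℝ} (hf : Integrable f μ) :
    ENNReal.ofReal (∫ x, f x ∂μ) ≤ ∫⁻ x, ENNReal.ofReal (f x) ∂μ := by
  rw [integral_eq_lintegral_pos_part_sub_lintegral_neg_part hf]
  exact (ENNReal.ofReal_le_ofReal (sub_le_self _ ENNReal.toReal_nonneg)).trans
    ENNReal.ofReal_toReal_le

lemma kobayashiDist_zero_le {w : EuclideanSpace ℂ (Fin n)} (hw : ‖w‖ < 1) :
    kobayashiDist (unitBall n) 0 w ≤ ENNReal.ofReal (Real.artanh ‖w‖) := by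
  have hdγ : ∀ t : ℝ, HasDerivAt (fun t : ℝ => t • w) w t := fun t => by
    simpa using (hasDerivAt_id t).smul_const w
  have hb : ∀ t ∈ Icc (0 : ℝ) 1, ‖w‖ * t ∈ Ioo (-1 : ℝ) 1 := fun t ht =>
    ⟨by nlinarith [norm_nonneg w, ht.1], by nlinarith [norm_nonneg w, ht.1, ht.2]⟩
  have hC1 : IsPiecewiseC1 (fun t : ℝ => t • w) :=
    ⟨1, fun i => i, by simp, by simp, fun i _ =>
      ⟨by simp, (contDiff_id.smul contDiff_const).contDiffOn⟩⟩
  have hmaps : MapsTo (fun t : ℝ => t • w) (Icc (0 : ℝ) 1) (unitBall n) := fun t ht => by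
    have : ‖t • w‖ < 1 := by
      rw [norm_smul, Real.norm_of_nonneg ht.1, mul_comm]
      exact (hb t ht).2
    exact this
  refine (iInf₂_le (fun t : ℝ => t • w) ⟨hC1, hmaps, by simp, by simp⟩).trans ?_
  have hne : ∀ t ∈ Icc (0 : ℝ) 1, 0 < 1 - (‖w‖ * t) ^ 2 := fun t ht => by
    nlinarith [(hb t ht).1, (hb t ht).2]
  have hder : ∀ t ∈ Icc (0 : ℝ) 1, HasDerivAt (fun t => Real.artanh (‖w‖ * t))
      (‖w‖ * (1 / (1 - (‖w‖ * t) ^ 2))) t := fun t ht => by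
    refine ((hasDerivAt_artanh (hb t ht)).comp t
      ((hasDerivAt_id t).const_mul ‖w‖)).congr_deriv ?_
    ring
  have hcont : ContinuousOn (fun t => ‖w‖ * (1 / (1 - (‖w‖ * t) ^ 2))) (Icc (0 : ℝ) 1) :=
    continuousOn_const.mul (continuousOn_const.div (by fun_prop) fun t ht => (hne t ht).ne')
  have hint : IntegrableOn (fun t => ‖w‖ * (1 / (1 - (‖w‖ * t) ^ 2))) (Icc (0 : ℝ) 1) :=
    hcont.integrableOn_Icc
  calc ∫⁻ t in Icc (0 : ℝ) 1, kobayashiMetric (unitBall n) (t • w) (deriv (fun t : ℝ => t • w) t)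
      ≤ ∫⁻ t in Icc (0 : ℝ) 1, ENNReal.ofReal (‖w‖ * (1 / (1 - (‖w‖ * t) ^ 2))) := by
        refine setLIntegral_mono' measurableSet_Icc fun t ht => ?_
        rw [(hdγ t).deriv]
        exact kobayashiMetric_radial_le hw ht
    _ = ENNReal.ofReal (∫ t in Icc (0 : ℝ) 1, ‖w‖ * (1 / (1 - (‖w‖ * t) ^ 2))) := by
        refine (ofReal_integral_eq_lintegral_ofReal hint ?_).symm
        refine (ae_restrict_iff' measurableSet_Icc).mpr (Filter.Eventually.of_forall fun t ht => ?_)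
        have := hne t ht
        simp only [Pi.zero_apply]
        positivity
    _ = ENNReal.ofReal (Real.artanh ‖w‖) := by
        rw [integral_Icc_eq_integral_Ioc, ← intervalIntegral.integral_of_le zero_le_one,
          intervalIntegral.integral_eq_sub_of_hasDerivAt (f := fun t => Real.artanh (‖w‖ * t))]
        · simp
        · rwa [uIcc_of_le zero_le_one]
        · exact (hcont.mono (by rw [uIcc_of_le zero_le_one])).intervalIntegrable

/-- The fundamental theorem of calculus for `artanh Re⟨γ, e⟩` on one `C¹` piece. Half-open intervals
let the pieces tile `[0, 1]`. -/
lemma ofReal_artanh_sub_le_lintegral {e : EuclideanSpace ℂ (Fin n)} (he : ‖e‖ ≤ 1)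
    {γ : ℝ → EuclideanSpace ℂ (Fin n)} {a b : ℝ} (hab : a < b)
    (hγ : ContDiffOn ℝ 1 γ (Icc a b)) (hm : MapsTo γ (Icc a b) (unitBall n)) :
    ENNReal.ofReal (Real.artanh (inner ℂ e (γ b)).re - Real.artanh (inner ℂ e (γ a)).re) ≤
      ∫⁻ t in Ioc a b, kobayashiMetric (unitBall n) (γ t) (deriv γ t) := by
  let ℓ : EuclideanSpace ℂ (Fin n) →L[ℝ] ℝ :=
    Complex.reCLM.comp ((innerSL ℂ e).restrictScalars ℝ)
  have hℓ : ∀ y, ℓ y = (inner ℂ e y).re := fun y => rfl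
  have hp : ∀ t ∈ Icc a b, ℓ (γ t) ∈ Ioo (-1 : ℝ) 1 := fun t ht => by
    have h1 : ‖(inner ℂ e (γ t) : ℂ)‖ < 1 := ((norm_inner_le_norm e (γ t)).trans
      (mul_le_of_le_one_left (norm_nonneg _) he)).trans_lt (hm ht)
    exact abs_lt.mp ((Complex.abs_re_le_norm _).trans_lt h1)
  have hne : ∀ t ∈ Icc a b, 1 - ℓ (γ t) ^ 2 ≠ 0 := fun t ht => by
    nlinarith [(hp t ht).1, (hp t ht).2]
  have hcγ : ContinuousOn (fun t => ℓ (γ t)) (Icc a b) :=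
    ℓ.continuous.comp_continuousOn hγ.continuousOn
  have hcd : ContinuousOn (derivWithin γ (Icc a b)) (Icc a b) :=
    hγ.continuousOn_derivWithin (uniqueDiffOn_Icc hab) le_rfl
  set F : ℝ → ℝ := fun t => ℓ (derivWithin γ (Icc a b) t) / (1 - ℓ (γ t) ^ 2) with hF
  have hcF : ContinuousOn F (Icc a b) :=
    (ℓ.continuous.comp_continuousOn hcd).div (continuousOn_const.sub (hcγ.pow 2)) hne
  -- At a break point `deriv γ` need not be the one-sided derivative; the two are compared only on
  -- the open interval, which has full measure.
  have hdγ : ∀ t ∈ Ioo a b, HasDerivAt γ (derivWithin γ (Icc a b) t) t := fun t ht =>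
    ((hγ.differentiableOn one_ne_zero t (Ioo_subset_Icc_self ht)).hasDerivWithinAt).hasDerivAt
      (Icc_mem_nhds ht.1 ht.2)
  have hder : ∀ t ∈ Ioo a b, HasDerivAt (fun t => Real.artanh (ℓ (γ t))) (F t) t := fun t ht => by
    have h := (hasDerivAt_artanh (hp t (Ioo_subset_Icc_self ht))).comp t
      (ℓ.hasFDerivAt.comp_hasDerivAt t (hdγ t ht))
    refine h.congr_deriv ?_
    rw [hF]; ring
  have hca : ContinuousOn (fun t => Real.artanh (ℓ (γ t))) (Icc a b) := fun t ht =>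
    (hasDerivAt_artanh (hp t ht)).continuousAt.comp_continuousWithinAt
      (f := fun t => ℓ (γ t)) (hcγ t ht)
  have hint := intervalIntegral.integral_eq_sub_of_hasDerivAt_of_le hab.le hca hder
    (hcF.mono (by rw [uIcc_of_le hab.le])).intervalIntegrable
  simp only [← hℓ]
  rw [← hint, intervalIntegral.integral_of_le hab.le, integral_Ioc_eq_integral_Ioo,
    setLIntegral_congr Ioo_ae_eq_Ioc.symm]
  refine (ofReal_integral_le_lintegral_ofReal (hcF.integrableOn_Icc.mono_set Ioo_subset_Icc_self)).trans ?_
  refine setLIntegral_mono' measurableSet_Ioo fun t ht => ?_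
  simp only [hF]
  rw [← (hdγ t ht).deriv]
  exact le_kobayashiMetric he _ _

lemma ofReal_artanh_le_kobayashiDist_zero {e : EuclideanSpace ℂ (Fin n)} (he : ‖e‖ ≤ 1)
    (w : EuclideanSpace ℂ (Fin n)) :
    ENNReal.ofReal (Real.artanh (inner ℂ e w).re) ≤ kobayashiDist (unitBall n) 0 w := by
  refine le_iInf₂ fun γ ⟨⟨k, s, hs0, hsk, hs⟩, hm, h0, h1⟩ => ?_
  have hmono : ∀ i j, i ≤ j → j ≤ k → s i ≤ s j := fun i j hij => by
    induction j, hij using Nat.le_induction with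
    | base => exact fun _ => le_rfl
    | succ j _ ih => exact fun hj => (ih (by omega)).trans (hs j hj).1.le
  have key : ∀ i ≤ k, ENNReal.ofReal (Real.artanh (inner ℂ e (γ (s i))).re) ≤
      ∫⁻ t in Icc (0 : ℝ) (s i), kobayashiMetric (unitBall n) (γ t) (deriv γ t) := fun i => by
    induction i with
    | zero => intro _; simp [hs0, h0]
    | succ i ih =>
      intro hi
      have ha : 0 ≤ s i := hs0 ▸ hmono 0 i (Nat.zero_le i) (by omega)
      have hb : s (i + 1) ≤ 1 := hsk ▸ hmono (i + 1) k hi le_rfl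
      have hab := (hs i hi).1
      have hstep := ofReal_artanh_sub_le_lintegral he hab (hs i hi).2
        (hm.mono_left (Icc_subset_Icc ha hb))
      have hdisj : Disjoint (Icc 0 (s i)) (Ioc (s i) (s (i + 1))) :=
        Set.disjoint_left.mpr fun t ht ht' => ht'.1.not_ge ht.2
      rw [← Icc_union_Ioc_eq_Icc ha hab.le, lintegral_union measurableSet_Ioc hdisj]
      refine le_trans ?_ (add_le_add (ih (by omega)) hstep)
      -- Increments may be negative, so the telescoping uses only subadditivity of `ENNReal.ofReal`.
      refine le_trans (ENNReal.ofReal_le_ofReal (le_of_eq ?_)) ENNReal.ofReal_add_le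
      ring
  have := key k le_rfl
  rwa [hsk, h1] at this

lemma kobayashiDist_unitBall_zero {w : EuclideanSpace ℂ (Fin n)} (hw : w ∈ unitBall n) :
    kobayashiDist (unitBall n) 0 w = ENNReal.ofReal (Real.artanh ‖w‖) := by
  refine le_antisymm (kobayashiDist_zero_le hw) ?_
  rcases eq_or_ne w 0 with rfl | hw0
  · simp
  have hr : ‖w‖ ≠ 0 := norm_ne_zero_iff.mpr hw0
  -- For `e = w/|w|` the functional attains `|w|` at `w`, matching the upper bound.
  have he : ‖(‖w‖ : ℂ)⁻¹ • w‖ ≤ 1 := by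
    rw [norm_smul, norm_inv, Complex.norm_real, norm_norm, inv_mul_cancel₀ hr]
  have hi : (inner ℂ ((‖w‖ : ℂ)⁻¹ • w) w).re = ‖w‖ := by
    have : inner ℂ ((‖w‖ : ℂ)⁻¹ • w) w = (‖w‖ : ℂ) := by
      have hrc : (‖w‖ : ℂ) ≠ 0 := by exact_mod_cast hr
      rw [inner_smul_left, inner_self_eq_norm_sq_to_K, map_inv₀, Complex.conj_ofReal]
      change (‖w‖ : ℂ)⁻¹ * (‖w‖ : ℂ) ^ 2 = ‖w‖
      field_simp
    rw [this, Complex.ofReal_re]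
  simpa only [hi] using ofReal_artanh_le_kobayashiDist_zero he w

end Kobayashi

/-! ### Solving for the parameter of an almost geodesic -/

section AlmostGeodesic

variable {n : ℕ}

/-- The parameter of the almost geodesic from `0` to a point of norm `r`. -/
def geodesicParameter (r t : ℝ) : ℝ :=
  1 / r * (((1 + r) ^ t - (1 - r) ^ t) / ((1 + r) ^ t + (1 - r) ^ t))

lemma artanh_mul_geodesicParameter {r t : ℝ} (hr : r ∈ Ioo (0 : ℝ) 1) :
    Real.artanh (geodesicParameter r t * r) = t * Real.artanh r := by
  rw [← artanh_rpow_quotient ⟨by linarith [hr.1], hr.2⟩, geodesicParameter]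
  congr 1
  have := hr.1.ne'
  field_simp

lemma geodesicParameter_mul_mem_Ioo {r : ℝ} (hr : r ∈ Ioo (0 : ℝ) 1) (t : ℝ) :
    geodesicParameter r t * r ∈ Ioo (-1 : ℝ) 1 := by
  have h := rpow_quotient_mem_Ioo (t := t) (r := r) ⟨by linarith [hr.1], hr.2⟩
  have h0 := hr.1.ne'
  have : geodesicParameter r t * r =
      ((1 + r) ^ t - (1 - r) ^ t) / ((1 + r) ^ t + (1 - r) ^ t) := by
    rw [geodesicParameter]; field_simp
  rwa [this]

/-- `artanh` is increasing and `t artanh r` lies between `artanh 0` and `artanh r`. -/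
lemma geodesicParameter_mem_Icc {r t : ℝ} (hr : r ∈ Ioo (0 : ℝ) 1) (ht : t ∈ Icc (0 : ℝ) 1) :
    geodesicParameter r t ∈ Icc (0 : ℝ) 1 := by
  have hL : 0 ≤ Real.artanh r := Real.artanh_nonneg hr.1.le
  have hmem := geodesicParameter_mul_mem_Ioo hr t
  have e := artanh_mul_geodesicParameter (t := t) hr
  have hr' : r ∈ Ioo (-1 : ℝ) 1 := ⟨by linarith [hr.1], hr.2⟩
  constructor
  · have : 0 ≤ geodesicParameter r t * r := by
      rw [← Real.artanh_le_artanh_iff (by norm_num) hmem, e, Real.artanh_zero]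
      exact mul_nonneg ht.1 hL
    exact nonneg_of_mul_nonneg_left this hr.1
  · have : geodesicParameter r t * r ≤ r := by
      rw [← Real.artanh_le_artanh_iff hmem hr', e]
      exact mul_le_of_le_one_left hL ht.2
    exact le_of_mul_le_mul_right (by simpa using this) hr.1

/-- The equation defining the parameter of an almost geodesic has a unique solution. -/
lemma kobayashiDist_scalarMul_eq_iff {z : EuclideanSpace ℂ (Fin n)} (hz : z ∈ unitBall n)
    (hz0 : z ≠ 0) {a t : ℝ} (ha : a ∈ Icc (0 : ℝ) 1) (ht : t ∈ Icc (0 : ℝ) 1) :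
    kobayashiDist (unitBall n) 0 (scalarMul (unitBall n) ballPhi 0 a z) =
      ENNReal.ofReal t * kobayashiDist (unitBall n) 0 z ↔ a = geodesicParameter ‖z‖ t := by
  have hr : ‖z‖ ∈ Ioo (0 : ℝ) 1 := ⟨norm_pos_iff.mpr hz0, hz⟩
  obtain ⟨hm, he⟩ := scalarMul_ballPhi ha hz
  have hn : ‖(a : ℂ) • z‖ = a * ‖z‖ := by
    rw [norm_smul, Complex.norm_real, Real.norm_of_nonneg ha.1]
  have hL : 0 ≤ Real.artanh ‖z‖ := Real.artanh_nonneg hr.1.le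
  have h1 : 0 ≤ a * ‖z‖ := mul_nonneg ha.1 hr.1.le
  have h2 : a * ‖z‖ < 1 := hn ▸ hm
  -- Both sides become `artanh` of points of `(-1, 1)`; injectivity and cancelling `‖z‖` leave the
  -- parameters.
  rw [he, kobayashiDist_unitBall_zero hm, kobayashiDist_unitBall_zero hz, hn,
    ← ENNReal.ofReal_mul ht.1,
    ENNReal.ofReal_eq_ofReal_iff (Real.artanh_nonneg h1) (mul_nonneg ht.1 hL),
    ← artanh_mul_geodesicParameter hr,
    Real.artanh_injOn.eq_iff ⟨by linarith, h2⟩ (geodesicParameter_mul_mem_Ioo hr t),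
    mul_left_inj' hr.1.ne']

lemma isAlmostGeodesic_iff {x y : EuclideanSpace ℂ (Fin n)} (hx : x ∈ unitBall n)
    (hy : y ∈ unitBall n) (γ : unitInterval → EuclideanSpace ℂ (Fin n)) :
    IsAlmostGeodesic (unitBall n) ballPhi 0 (kobayashiDist (unitBall n)) x y γ ↔
      ∀ t : unitInterval, γ t = Function.invFunOn (ballPhi x) (unitBall n)
        ((geodesicParameter ‖ballPhi x y‖ t : ℂ) • ballPhi x y) := by
  have hz : ballPhi x y ∈ unitBall n := ballPhi_mem hx hy
  unfold IsAlmostGeodesic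
  generalize ballPhi x y = z at *
  constructor
  · rintro ⟨-, α, hα, hγ⟩ t
    rw [hγ t, (scalarMul_ballPhi (α t).2 hz).2]
    rcases eq_or_ne z 0 with rfl | hz0
    · rw [smul_zero, smul_zero]
    · rw [(kobayashiDist_scalarMul_eq_iff hz hz0 (α t).2 t.2).mp (hα t)]
  · intro h
    obtain ⟨α, hα⟩ : ∃ α : unitInterval → unitInterval, ∀ t,
        kobayashiDist (unitBall n) 0 (scalarMul (unitBall n) ballPhi 0 (α t) z) =
          ENNReal.ofReal t * kobayashiDist (unitBall n) 0 z ∧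
        scalarMul (unitBall n) ballPhi 0 (α t) z = (geodesicParameter ‖z‖ t : ℂ) • z := by
      rcases eq_or_ne z 0 with rfl | hz0
      -- For `z = 0` both sides of the distance equation vanish whatever `α` is, so any choice
      -- serves.
      · refine ⟨fun _ => 0, fun t => ?_⟩
        rw [(scalarMul_ballPhi (0 : unitInterval).2 hz).2, smul_zero, smul_zero,
          kobayashiDist_unitBall_zero hz]
        simp
      · have hr : ‖z‖ ∈ Ioo (0 : ℝ) 1 := ⟨norm_pos_iff.mpr hz0, hz⟩
        refine ⟨fun t => ⟨geodesicParameter ‖z‖ t, geodesicParameter_mem_Icc hr t.2⟩, fun t => ?_⟩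
        have hg := geodesicParameter_mem_Icc hr t.2
        exact ⟨(kobayashiDist_scalarMul_eq_iff hz hz0 hg t.2).mpr rfl, (scalarMul_ballPhi hg hz).2⟩
    refine ⟨fun t => ?_, α, fun t => (hα t).1, fun t => by rw [h t, (hα t).2]⟩
    have hm : (geodesicParameter ‖z‖ t : ℂ) • z ∈ unitBall n := by
      rw [← (hα t).2, (scalarMul_ballPhi (α t).2 hz).2]
      exact (scalarMul_ballPhi (α t).2 hz).1
    rw [h t, invFunOn_ballPhi hx hm]
    exact ballPhi_mem (neg_mem_unitBall hx) hm

end AlmostGeodesic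
end ComplexDomain

end

theorem corollary6p4 (n : ℕ) :
    ComplexDomain.IsIdentityElement (ComplexDomain.unitBall n) ComplexDomain.ballPhi 0 ∧
    (∀ x ∈ ComplexDomain.unitBall n,
      ComplexDomain.IsAutomorphism (ComplexDomain.unitBall n) (ComplexDomain.ballPhi x)) ∧
    ∀ x ∈ ComplexDomain.unitBall n, ∀ y ∈ ComplexDomain.unitBall n,
      ∀ z : EuclideanSpace ℂ (Fin n), z = ComplexDomain.ballPhi x y →
      ∀ γ : unitInterval → EuclideanSpace ℂ (Fin n),
        ComplexDomain.IsAlmostGeodesic (ComplexDomain.unitBall n) ComplexDomain.ballPhi 0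
            (ComplexDomain.kobayashiDist (ComplexDomain.unitBall n)) x y γ ↔
          ∀ t : unitInterval,
            γ t = Function.invFunOn (ComplexDomain.ballPhi x) (ComplexDomain.unitBall n)
              (((1 / ‖z‖ * (((1 + ‖z‖) ^ (t : ℝ) - (1 - ‖z‖) ^ (t : ℝ)) /
                ((1 + ‖z‖) ^ (t : ℝ) + (1 - ‖z‖) ^ (t : ℝ))) : ℝ) : ℂ) • z) := by
  refine ⟨ComplexDomain.isIdentityElement_ballPhi,
    fun x hx => ComplexDomain.isAutomorphism_ballPhi hx, fun x hx y hy z hz γ => ?_⟩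
  rw [hz]
  exact ComplexDomain.isAlmostGeodesic_iff hx hy γ
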